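/- Let $\mathcal G$ be a connected undirected simple graph on the vertex set $\{0,1,\dots,N-1\}$, let $L=D-A$ be its Laplacian matrix, let $\lambda_0\le\lambda_1\le\dots\le\lambda_{N-1}$ be the eigenvalues of $L$ (so $0=\lambda_0<\lambda_1$ when $N\ge 2$), and let $u_0,\dots,u_{N-1}$ be an orthonormal family of corresponding real eigenvectors, $Lu_i=\lambda_iu_i$; write $u_{ij}$ for the $j$th entry of $u_i$. Consider the noisy second-order consensus dynamics $$\begin{bmatrix}\dot x_1(t)\\ \dot x_2(t)\end{bmatrix}=\begin{bmatrix}0&I\\-L&-L\end{bmatrix}\begin{bmatrix}x_1(t)\\ x_2(t)\end{bmatrix}+\begin{bmatrix}0\\ I\end{bmatrix}w(t),$$ where $x_1(t),x_2(t)\in\mathbb R^N$ and $w$ is an $N$-vector of uncorrelated unit-intensity Gaussian white noise processes; that is, $dx_1=x_2\,dt$ and $dx_2=(-Lx_1-Lx_2)\,dt+dW$ with $W$ a standard $N$-dimensional Wiener process. Let $(x_1,x_2)$ be any solution whose initial state $(x_1(0),x_2(0))$ has finite second moments. Then for all vertices $j,k$ the expectation $\mathbb E[(x_{1j}(t)-x_{1k}(t))^2]$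 is finite for every $t\ge0$, and the pairwise variance $H_{\mathrm{SO}}(j,k)=\lim_{t\to\infty}\mathbb E\big[(x_{1j}(t)-x_{1k}(t))^2\big]$ exists and equals $$H_{\mathrm{SO}}(j,k)=\sum_{i=1}^{N-1}\frac{(u_{ij}-u_{ik})^2}{2\lambda_i^2}.$$ -/

import Mathlib

open MeasureTheory ProbabilityTheory Filter Topology Matrix
open scoped NNReal

/-- The drift matrix `[0, I; -L, -L]` of the second-order consensus dynamics on `G`,
where `L` is the Laplacian matrix of `G`. The index `Sum.inl j` stands for the coordinate
`x₁ⱼ`, the index `Sum.inr j` for the coordinate `x₂ⱼ`. -/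
noncomputable def consensusMatrix {N : ℕ} (G : SimpleGraph (Fin N)) [DecidableRel G.Adj] :
    Matrix (Fin N ⊕ Fin N) (Fin N ⊕ Fin N) ℝ :=
  Matrix.fromBlocks 0 1 (-G.lapMatrix ℝ) (-G.lapMatrix ℝ)

/-- The input matrix `[0; I]`. -/
def noiseMatrix (N : ℕ) : Matrix (Fin N ⊕ Fin N) (Fin N) ℝ :=
  Matrix.fromRows 0 1

/-- A standard `N`-dimensional Wiener process: independent standard real Brownian motions.
It is the time integral of a vector of `N` uncorrelated unit Gaussian white noise processes. -/
structure IsWienerProcess {Ω : Type*} [MeasurableSpace Ω] {N : ℕ} (P : Measure Ω)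
    (W : ℝ≥0 → Ω → Fin N → ℝ) : Prop where
  brownian : ∀ i, IsBrownianReal (fun t ω ↦ W t ω i) P
  indep : iIndepFun (fun (i : Fin N) (ω : Ω) (t : ℝ≥0) ↦ W t ω i) P

/-- `X = (x₁, x₂)` is a solution of `dX = [0, I; -L, -L] X dt + [0; I] dW`: almost surely, `X`
has continuous paths and satisfies the integrated equation at all times. The noise being
additive, no stochastic integral is involved. -/
structure IsConsensusSolution {Ω : Type*} [MeasurableSpace Ω] {N : ℕ}
    (G : SimpleGraph (Fin N)) [DecidableRel G.Adj] (P : Measure Ω)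
    (W : ℝ≥0 → Ω → Fin N → ℝ) (X : ℝ≥0 → Ω → Fin N ⊕ Fin N → ℝ) : Prop where
  cont : ∀ᵐ ω ∂P, Continuous (fun t ↦ X t ω)
  eqn : ∀ᵐ ω ∂P, ∀ t : ℝ≥0,
    X t ω = X 0 ω + (∫ s in (0 : ℝ)..t, consensusMatrix G *ᵥ X s.toNNReal ω)
      + noiseMatrix N *ᵥ W t ω

/-- The pairwise variance of vertices `j` and `k` exists and equals `v`:
`lim_{t → ∞} 𝔼[(x₁ⱼ(t) - x₁ₖ(t))²] = v`, all these expectations being finite. -/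
def HasPairwiseVariance {Ω : Type*} [MeasurableSpace Ω] {N : ℕ} (P : Measure Ω)
    (X : ℝ≥0 → Ω → Fin N ⊕ Fin N → ℝ) (j k : Fin N) (v : ℝ) : Prop :=
  (∀ t, Integrable (fun ω ↦ (X t ω (Sum.inl j) - X t ω (Sum.inl k)) ^ 2) P) ∧
    Tendsto (fun t : ℝ≥0 ↦ ∫ ω, (X t ω (Sum.inl j) - X t ω (Sum.inl k)) ^ 2 ∂P) atTop (𝓝 v)

/-! Projecting on the eigenvectors `u i` decouples the system into scalar damped oscillators `y'' +
lam y' + lam y = noise` (`IsConsensusSolution.ae_mode_eq`). Modes with `lam i = 0` are constant on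
the connected graph, so they cancel in `x₁ⱼ - x₁ₖ`. In the other modes the initial state is
multiplied by kernels `p`, `g` tending to 0, so only the noise survives. The noise term is formally
`∫ g (t - s) dB s`. Integrating by parts turns it into a pathwise integral of `B` against `p - lam g
= g'`, so its second moment needs only Fubini and the covariance `min s r`
(`IsWienerProcess.integral_integral_mul_integral`, `integral_integral_min`). Orthonormality removes
the cross terms between modes, and each mode contributes `∫ g²`, which tends to `1 / (2 lam²)`
(`tendsto_integral_sq`). -/

/-! ### The scalar damped oscillator and its impulse response. -/

/-- `(p, g)` is the first row of the fundamental matrix `exp (t [0, 1; -lam, -lam])` of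
`y'' + lam y' + lam y = 0`; in particular `g` is the impulse response of this equation. -/
structure IsImpulseKernel (lam : ℝ) (p g : ℝ → ℝ) : Prop where
  deriv_left : ∀ t, HasDerivAt p (-(lam * g t)) t
  deriv_right : ∀ t, HasDerivAt g (p t - lam * g t) t
  left_zero : p 0 = 1
  right_zero : g 0 = 0

theorem exists_isImpulseKernel (lam : ℝ) : ∃ p g : ℝ → ℝ, IsImpulseKernel lam p g := by
  -- `A` is the transpose of `[0, 1; -lam, -lam]`, so the orbit of `(1, 0)` is the first row of the
  -- exponential.
  let A : ℝ × ℝ →L[ℝ] ℝ × ℝ :=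
    ((-lam) • ContinuousLinearMap.snd ℝ ℝ ℝ).prod
      (ContinuousLinearMap.fst ℝ ℝ ℝ - lam • ContinuousLinearMap.snd ℝ ℝ ℝ)
  have key (t : ℝ) : HasDerivAt (fun s : ℝ ↦ (NormedSpace.exp (s • A)) (1, 0))
      (A ((NormedSpace.exp (t • A)) (1, 0))) t := by
    have h := hasDerivAt_exp_smul_const' (𝕂 := ℝ) A t
    exact ((ContinuousLinearMap.apply ℝ (ℝ × ℝ) ((1, 0) : ℝ × ℝ)).hasFDerivAt.comp_hasDerivAt t h)
  refine ⟨fun s ↦ ((NormedSpace.exp (s • A)) (1, 0)).1,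
    fun s ↦ ((NormedSpace.exp (s • A)) (1, 0)).2, fun t ↦ ?_, fun t ↦ ?_, ?_, ?_⟩
  · have := (ContinuousLinearMap.fst ℝ ℝ ℝ).hasFDerivAt.comp_hasDerivAt t (key t)
    simpa [A, Function.comp_def] using this
  · have := (ContinuousLinearMap.snd ℝ ℝ ℝ).hasFDerivAt.comp_hasDerivAt t (key t)
    simpa [A, Function.comp_def] using this
  · simp
  · simp

theorem tendsto_zero_of_sq {α : Type*} {l : Filter α} {f : α → ℝ}
    (h : Tendsto (fun x ↦ f x ^ 2) l (𝓝 0)) : Tendsto f l (𝓝 0) := by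
  rw [tendsto_zero_iff_abs_tendsto_zero]
  simpa [Real.sqrt_sq_eq_abs, Function.comp_def] using h.sqrt

namespace IsImpulseKernel

variable {lam : ℝ} {p g : ℝ → ℝ}

theorem continuous_left (h : IsImpulseKernel lam p g) : Continuous p :=
  continuous_iff_continuousAt.2 fun t ↦ (h.deriv_left t).continuousAt

theorem continuous_right (h : IsImpulseKernel lam p g) : Continuous g :=
  continuous_iff_continuousAt.2 fun t ↦ (h.deriv_right t).continuousAt

theorem hasDerivAt_deriv (h : IsImpulseKernel lam p g) (t : ℝ) :
    HasDerivAt (fun s ↦ p s - lam * g s) (-(lam * g t) - lam * (p t - lam * g t)) t :=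
  (h.deriv_left t).sub ((h.deriv_right t).const_mul lam)

/-- A Lyapunov function decays exponentially along the kernel. -/
theorem tendsto_lyapunov (h : IsImpulseKernel lam p g) (hlam : 0 < lam) :
    Tendsto (fun t ↦ lam * (g t + (p t - lam * g t)) ^ 2 + 2 * lam ^ 2 * g t ^ 2
      + (p t - lam * g t) ^ 2) atTop (𝓝 0) := by
  set U : ℝ → ℝ := fun t ↦ lam * (g t + (p t - lam * g t)) ^ 2 + 2 * lam ^ 2 * g t ^ 2
      + (p t - lam * g t) ^ 2 with hU
  have hU' (t : ℝ) : HasDerivAt U (-(2 * lam ^ 2) * (g t ^ 2 + (p t - lam * g t) ^ 2)) t := by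
    have h1 := h.deriv_right t
    have h2 := h.hasDerivAt_deriv t
    refine ((((h1.add h2).pow 2).const_mul lam).add ((h1.pow 2).const_mul (2 * lam ^ 2))
      |>.add (h2.pow 2)).congr_deriv ?_
    simp only [Pi.add_apply]
    push_cast
    ring
  -- With `q = p - lam g`, `(g + q)² ≤ 2 (g² + q²)` gives `U ≤ K (g² + q²)`; hence `U' ≤ -e U` with
  -- `e = 2 lam² / K`.
  set K : ℝ := 2 * lam + 2 * lam ^ 2 + 1
  have hK : 0 < K := by positivity
  set e : ℝ := 2 * lam ^ 2 / K
  have he : 0 < e := by positivity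
  have hbound (t : ℝ) : e * U t ≤ 2 * lam ^ 2 * (g t ^ 2 + (p t - lam * g t) ^ 2) := by
    have : U t ≤ K * (g t ^ 2 + (p t - lam * g t) ^ 2) := by
      simp only [hU, K]
      generalize p t - lam * g t = q
      nlinarith [mul_nonneg hlam.le (sq_nonneg (g t - q)), mul_nonneg (sq_nonneg lam) (sq_nonneg q),
        sq_nonneg (g t)]
    calc e * U t ≤ e * (K * (g t ^ 2 + (p t - lam * g t) ^ 2)) := by gcongr
      _ = _ := by simp only [e]; field_simp
  have hanti : Antitone fun t ↦ Real.exp (e * t) * U t := by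
    have hd (t : ℝ) : HasDerivAt (fun t ↦ Real.exp (e * t) * U t)
        (Real.exp (e * t) * (e * U t - 2 * lam ^ 2 * (g t ^ 2 + (p t - lam * g t) ^ 2))) t := by
      refine ((((hasDerivAt_id t).const_mul e).exp).mul (hU' t)).congr_deriv ?_
      simp only [id]
      ring
    refine antitone_of_deriv_nonpos (fun t ↦ (hd t).differentiableAt) fun t ↦ ?_
    rw [(hd t).deriv]
    exact mul_nonpos_of_nonneg_of_nonpos (Real.exp_pos _).le (by linarith [hbound t])
  have hlim : Tendsto (fun t : ℝ ↦ U 0 * Real.exp (-(e * t))) atTop (𝓝 0) := by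
    have : Tendsto (fun t : ℝ ↦ e * t) atTop atTop := tendsto_id.const_mul_atTop he
    simpa using (Real.tendsto_exp_neg_atTop_nhds_zero.comp this).const_mul (U 0)
  refine squeeze_zero' (.of_forall fun t ↦ by positivity) ?_ hlim
  filter_upwards [eventually_ge_atTop 0] with t ht
  have h1 : Real.exp (e * t) * U t ≤ U 0 := by simpa using hanti ht
  rw [Real.exp_neg, ← div_eq_mul_inv, le_div_iff₀ (Real.exp_pos _), mul_comm]
  exact h1

theorem tendsto_right (h : IsImpulseKernel lam p g) (hlam : 0 < lam) :
    Tendsto g atTop (𝓝 0) := by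
  have h1 : Tendsto (fun t ↦ g t ^ 2) atTop (𝓝 0) := by
    have := (h.tendsto_lyapunov hlam).const_mul (1 / (2 * lam ^ 2))
    rw [mul_zero] at this
    refine squeeze_zero (fun t ↦ by positivity) (fun t ↦ ?_) this
    rw [one_div, inv_mul_eq_div, le_div_iff₀ (by positivity)]
    nlinarith [mul_nonneg hlam.le (sq_nonneg (g t + (p t - lam * g t))),
      sq_nonneg (p t - lam * g t)]
  exact tendsto_zero_of_sq h1

theorem tendsto_deriv (h : IsImpulseKernel lam p g) (hlam : 0 < lam) :
    Tendsto (fun t ↦ p t - lam * g t) atTop (𝓝 0) := by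
  have h1 : Tendsto (fun t ↦ (p t - lam * g t) ^ 2) atTop (𝓝 0) := by
    refine squeeze_zero (fun t ↦ by positivity) (fun t ↦ ?_) (h.tendsto_lyapunov hlam)
    have := mul_nonneg hlam.le (sq_nonneg (g t + (p t - lam * g t)))
    have : 0 ≤ 2 * lam ^ 2 * g t ^ 2 := by positivity
    linarith
  exact tendsto_zero_of_sq h1

theorem tendsto_left (h : IsImpulseKernel lam p g) (hlam : 0 < lam) :
    Tendsto p atTop (𝓝 0) := by
  simpa using (h.tendsto_deriv hlam).add ((h.tendsto_right hlam).const_mul lam)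

/-- The energy of the impulse response. -/
theorem tendsto_integral_sq (h : IsImpulseKernel lam p g) (hlam : 0 < lam) :
    Tendsto (fun t ↦ ∫ s in (0 : ℝ)..t, g s ^ 2) atTop (𝓝 (1 / (2 * lam ^ 2))) := by
  -- The quadratic form in `(g, g')` whose derivative along the flow is exactly `g²`: the
  -- coefficients make the `g g'` and `g'²` terms cancel.
  set V : ℝ → ℝ := fun t ↦ -(1 / (2 * lam ^ 2)) * (lam * (lam + 1) * g t ^ 2
    + 2 * lam * (g t * (p t - lam * g t)) + (p t - lam * g t) ^ 2) with hV
  have hV' (t : ℝ) : HasDerivAt V (g t ^ 2) t := by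
    have h1 := h.deriv_right t
    have h2 := h.hasDerivAt_deriv t
    refine (((((h1.pow 2).const_mul (lam * (lam + 1))).add ((h1.mul h2).const_mul (2 * lam))).add
      (h2.pow 2)).const_mul (-(1 / (2 * lam ^ 2)))).congr_deriv ?_
    push_cast
    field_simp
    ring
  have hint (t : ℝ) : ∫ s in (0 : ℝ)..t, g s ^ 2 = V t + 1 / (2 * lam ^ 2) := by
    rw [intervalIntegral.integral_eq_sub_of_hasDerivAt (fun s _ ↦ hV' s)
      ((h.continuous_right.pow 2).intervalIntegrable _ _)]
    simp [hV, h.left_zero, h.right_zero]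
  simp_rw [hint]
  have hg := h.tendsto_right hlam
  have hq := h.tendsto_deriv hlam
  have : Tendsto V atTop (𝓝 0) := by
    simpa only [ne_eq, OfNat.ofNat_ne_zero, not_false_eq_true, zero_pow, mul_zero, add_zero]
      using ((((hg.pow 2).const_mul (lam * (lam + 1))).add
      ((hg.mul hq).const_mul (2 * lam))).add (hq.pow 2)).const_mul (-(1 / (2 * lam ^ 2)))
  simpa only [zero_add] using this.add_const (1 / (2 * lam ^ 2))

/-- Variation of constants for `a' = b`, `b' = -lam a - lam b + w'`, with `w'` integrated by
parts. -/
theorem variation_of_constants (h : IsImpulseKernel lam p g) {a b w : ℝ → ℝ}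
    (ha : Continuous a) (hb : Continuous b) (hw : Continuous w)
    (ha_eq : ∀ t, 0 ≤ t → a t = a 0 + ∫ s in (0 : ℝ)..t, b s)
    (hb_eq : ∀ t, 0 ≤ t → b t = b 0 + (∫ s in (0 : ℝ)..t, (-lam * a s - lam * b s)) + w t)
    {t : ℝ} (ht : 0 ≤ t) :
    a t = p t * a 0 + g t * b 0 + ∫ s in (0 : ℝ)..t, (p (t - s) - lam * g (t - s)) * w s := by
  -- `b` is not differentiable, but `y`, equal to `b - w` for nonnegative times, is. Defining `a₁`
  -- and `y` by integrals gives two-sided derivatives at 0 as well, where the equations say nothing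
  -- about negative times.
  set a₁ : ℝ → ℝ := fun t ↦ a 0 + ∫ s in (0 : ℝ)..t, b s
  set y : ℝ → ℝ := fun t ↦ b 0 + ∫ s in (0 : ℝ)..t, (-lam * a s - lam * b s)
  have hc : Continuous fun s ↦ -lam * a s - lam * b s := by fun_prop
  have ha₁ (s : ℝ) : HasDerivAt a₁ (b s) s :=
    ((hb.integral_hasStrictDerivAt 0 s).hasDerivAt).const_add _
  have hy (s : ℝ) : HasDerivAt y (-lam * a s - lam * b s) s :=
    ((hc.integral_hasStrictDerivAt 0 s).hasDerivAt).const_add _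
  have hts (s : ℝ) : HasDerivAt (fun s ↦ t - s) (-1) s := by
    simpa using (hasDerivAt_id s).const_sub t
  have hF (s : ℝ) (hs : s ∈ Set.uIcc 0 t) :
      HasDerivAt (fun s ↦ p (t - s) * a₁ s + g (t - s) * y s)
        ((p (t - s) - lam * g (t - s)) * w s) s := by
    rw [Set.uIcc_of_le ht] at hs
    refine ((((h.deriv_left (t - s)).comp s (hts s)).mul (ha₁ s)).add
      (((h.deriv_right (t - s)).comp s (hts s)).mul (hy s))).congr_deriv ?_
    have e1 : a₁ s = a s := (ha_eq s hs.1).symm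
    have e2 : b s = y s + w s := hb_eq s hs.1
    simp only [Function.comp_apply, e1, e2]
    ring
  have hp := h.continuous_left
  have hg := h.continuous_right
  rw [intervalIntegral.integral_eq_sub_of_hasDerivAt hF
    (Continuous.intervalIntegrable (by fun_prop) _ _)]
  have e0 : a₁ t = a t := (ha_eq t ht).symm
  simp [h.left_zero, h.right_zero, e0, a₁, y]

/-- The covariance computation behind the Itô isometry for `∫ g (t - s) dB s`, written in the form
integrated by parts. -/
theorem integral_integral_min (h : IsImpulseKernel lam p g) {t : ℝ} (ht : 0 ≤ t) :
    ∫ s in (0 : ℝ)..t, ∫ r in (0 : ℝ)..t,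
      (p (t - s) - lam * g (t - s)) * ((p (t - r) - lam * g (t - r)) * min s r)
      = ∫ s in (0 : ℝ)..t, g s ^ 2 := by
  have hp := h.continuous_left
  have hg := h.continuous_right
  have hG (s : ℝ) : HasDerivAt (fun s ↦ g (t - s)) (-(p (t - s) - lam * g (t - s))) s := by
    refine ((h.deriv_right (t - s)).comp s ((hasDerivAt_id s).const_sub t)).congr_deriv ?_
    ring
  have hI (s : ℝ) : HasDerivAt (fun s ↦ ∫ r in (0 : ℝ)..s, g (t - r)) (g (t - s)) s := by
    have hc : Continuous fun r ↦ g (t - r) := by fun_prop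
    exact (hc.integral_hasStrictDerivAt 0 s).hasDerivAt
  have inner (s : ℝ) (hs : s ∈ Set.Icc 0 t) :
      ∫ r in (0 : ℝ)..t, (p (t - r) - lam * g (t - r)) * min s r = ∫ r in (0 : ℝ)..s, g (t - r) := by
    have hcont : Continuous fun r ↦ (p (t - r) - lam * g (t - r)) * min s r := by fun_prop
    rw [← intervalIntegral.integral_add_adjacent_intervals
      (hcont.intervalIntegrable 0 s) (hcont.intervalIntegrable s t)]
    have e1 : ∫ r in (0 : ℝ)..s, (p (t - r) - lam * g (t - r)) * min s r
        = (∫ r in (0 : ℝ)..s, g (t - r)) - g (t - s) * s := by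
      have hd (r : ℝ) : HasDerivAt (fun r ↦ (∫ r in (0 : ℝ)..r, g (t - r)) - g (t - r) * r)
          ((p (t - r) - lam * g (t - r)) * r) r := by
        refine ((hI r).sub ((hG r).mul (hasDerivAt_id r))).congr_deriv ?_
        simp only [id]
        ring
      rw [intervalIntegral.integral_congr
        (g := fun r ↦ (p (t - r) - lam * g (t - r)) * r) fun r hr ↦ ?_]
      · rw [intervalIntegral.integral_eq_sub_of_hasDerivAt (fun r _ ↦ hd r)
          (Continuous.intervalIntegrable (by fun_prop) _ _)]
        simp
      · rw [Set.uIcc_of_le hs.1] at hr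
        simp [min_eq_right hr.2]
    have e2 : ∫ r in s..t, (p (t - r) - lam * g (t - r)) * min s r = g (t - s) * s := by
      have hd (r : ℝ) : HasDerivAt (fun r ↦ -(g (t - r) * s))
          ((p (t - r) - lam * g (t - r)) * s) r := by
        refine ((hG r).mul_const s).neg.congr_deriv ?_
        ring
      rw [intervalIntegral.integral_congr
        (g := fun r ↦ (p (t - r) - lam * g (t - r)) * s) fun r hr ↦ ?_]
      · rw [intervalIntegral.integral_eq_sub_of_hasDerivAt (fun r _ ↦ hd r)
          (Continuous.intervalIntegrable (by fun_prop) _ _)]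
        simp [h.right_zero]
      · rw [Set.uIcc_of_le hs.2] at hr
        simp [min_eq_left hr.1]
    rw [e1, e2]
    ring
  -- After the inner integration by parts, the integrand is `g (t - s)²` minus the derivative of `g
  -- (t - s) * ∫ r in 0..s, g (t - r)`, a product that vanishes at `s = 0` and, since `g 0 = 0`, at
  -- `s = t`.
  have e : ∫ s in (0 : ℝ)..t, ∫ r in (0 : ℝ)..t,
      (p (t - s) - lam * g (t - s)) * ((p (t - r) - lam * g (t - r)) * min s r)
      = ∫ s in (0 : ℝ)..t, (g (t - s) ^ 2 -
        (-(p (t - s) - lam * g (t - s)) * (∫ r in (0 : ℝ)..s, g (t - r))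
          + g (t - s) * g (t - s))) := by
    refine intervalIntegral.integral_congr fun s hs ↦ ?_
    rw [Set.uIcc_of_le ht] at hs
    simp only [intervalIntegral.integral_const_mul, inner s hs]
    ring
  have hIc : Continuous fun s ↦ ∫ r in (0 : ℝ)..s, g (t - r) :=
    continuous_iff_continuousAt.2 fun s ↦ (hI s).continuousAt
  rw [e, intervalIntegral.integral_sub (Continuous.intervalIntegrable (by fun_prop) _ _)
    (Continuous.intervalIntegrable (by fun_prop) _ _),
    intervalIntegral.integral_eq_sub_of_hasDerivAt (fun s _ ↦ (hG s).mul (hI s))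
      (Continuous.intervalIntegrable (by fun_prop) _ _),
    intervalIntegral.integral_comp_sub_left (fun s ↦ g s ^ 2)]
  simp [h.right_zero]

end IsImpulseKernel

/-! ### Square integrability and Fubini for time integrals of processes. -/

/-- The Cauchy–Schwarz inequality for integrals. -/
theorem sq_integral_mul_le {α : Type*} [MeasurableSpace α] {μ : Measure α} {f g : α → ℝ}
    (hf : MemLp f 2 μ) (hg : MemLp g 2 μ) :
    (∫ x, f x * g x ∂μ) ^ 2 ≤ (∫ x, f x ^ 2 ∂μ) * ∫ x, g x ^ 2 ∂μ := by
  have h (c : ℝ) : 0 ≤ (∫ x, f x ^ 2 ∂μ) * (c * c) + (2 * ∫ x, f x * g x ∂μ) * c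
      + ∫ x, g x ^ 2 ∂μ := by
    have h0 : 0 ≤ ∫ x, (c * f x + g x) ^ 2 ∂μ := integral_nonneg fun x ↦ sq_nonneg _
    have hfg : Integrable (fun x ↦ f x * g x) μ := hf.integrable_mul hg
    have e : ∫ x, (c * f x + g x) ^ 2 ∂μ
        = ∫ x, (c * c * f x ^ 2 + 2 * c * (f x * g x) + g x ^ 2) ∂μ :=
      integral_congr_ae (.of_forall fun x ↦ by ring)
    have h12 : Integrable (fun x ↦ c * c * f x ^ 2 + 2 * c * (f x * g x)) μ :=
      (hf.integrable_sq.const_mul _).add (hfg.const_mul _)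
    rw [e, integral_add h12 hg.integrable_sq,
      integral_add (hf.integrable_sq.const_mul _) (hfg.const_mul _),
      integral_const_mul, integral_const_mul] at h0
    linarith
  have := discrim_le_zero h
  rw [discrim] at this
  linarith

section Fubini

variable {Ω : Type*} [MeasurableSpace Ω] {P : Measure Ω}

/-- A process with almost surely continuous paths is jointly measurable up to a null set. -/
theorem aestronglyMeasurable_prod_of_continuous {B : ℝ≥0 → Ω → ℝ}
    (hm : ∀ t, AEMeasurable (B t) P) (hc : ∀ᵐ ω ∂P, Continuous fun t ↦ B t ω)
    (ν : Measure ℝ) [SFinite ν] :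
    AEStronglyMeasurable (fun z : Ω × ℝ ↦ B z.2.toNNReal z.1) (P.prod ν) := by
  -- Sampling at the times `⌊s n⌋ / n` involves only countably many random variables, so
  -- measurability is clear; path continuity gives the limit.
  refine aestronglyMeasurable_of_tendsto_ae atTop
    (f := fun (n : ℕ) (z : Ω × ℝ) ↦ B ((⌊max z.2 0 * n⌋₊ : ℝ) / n).toNNReal z.1) (fun n ↦ ?_) ?_
  · let τ (k : ℕ) : ℝ≥0 := ((k : ℝ) / n).toNNReal
    have hmk : Measurable fun q : Ω × ℕ ↦ (hm (τ q.2)).mk (B (τ q.2)) q.1 :=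
      measurable_from_prod_countable_left fun k ↦ (hm (τ k)).measurable_mk
    have hfl : Measurable fun z : Ω × ℝ ↦ (z.1, ⌊max z.2 0 * n⌋₊) := by fun_prop
    refine AEMeasurable.aestronglyMeasurable ⟨_, hmk.comp hfl, ?_⟩
    have hae : ∀ᵐ ω ∂P, ∀ k, B (τ k) ω = (hm (τ k)).mk (B (τ k)) ω :=
      ae_all_iff.2 fun k ↦ (hm (τ k)).ae_eq_mk
    filter_upwards [Measure.quasiMeasurePreserving_fst.ae hae] with z hz
    exact hz _
  · filter_upwards [Measure.quasiMeasurePreserving_fst.ae hc] with z hz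
    have h1 := (tendsto_nat_floor_mul_div_atTop (R := ℝ) (le_max_right z.2 0)).comp
      tendsto_natCast_atTop_atTop
    have h2 := (hz.tendsto _).comp ((continuous_real_toNNReal.tendsto _).comp h1)
    have e : (max z.2 0).toNNReal = z.2.toNNReal := by
      rcases le_total z.2 0 with h | h
      · simp [h, Real.toNNReal_of_nonpos h]
      · simp [h]
    rw [e] at h2
    exact h2

variable [IsProbabilityMeasure P] {ν : Measure ℝ} [IsFiniteMeasure ν] {Z : ℝ → Ω → ℝ} {C : ℝ}

theorem memLp_two_prod (hZ : AEStronglyMeasurable (fun z : Ω × ℝ ↦ Z z.2 z.1) (P.prod ν))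
    (hZ2 : ∀ᵐ s ∂ν, MemLp (Z s) 2 P) (hC : ∀ᵐ s ∂ν, ∫ ω, Z s ω ^ 2 ∂P ≤ C) :
    MemLp (fun z : Ω × ℝ ↦ Z z.2 z.1) 2 (P.prod ν) := by
  refine (memLp_two_iff_integrable_sq hZ).2 ?_
  refine (integrable_prod_iff' (hZ.pow 2)).2 ⟨?_, ?_⟩
  · filter_upwards [hZ2] with s hs using hs.integrable_sq
  · refine Integrable.of_bound (C := C) ((hZ.pow 2).norm.prod_swap.integral_prod_right') ?_
    filter_upwards [hC] with s hs
    rw [Real.norm_of_nonneg (integral_nonneg fun ω ↦ norm_nonneg _)]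
    simpa using hs

/-- Cauchy–Schwarz against the constant 1 bounds the squared time integral by the total mass of `ν`
times the integral of the square. -/
theorem memLp_two_integral (hZ : MemLp (fun z : Ω × ℝ ↦ Z z.2 z.1) 2 (P.prod ν)) :
    MemLp (fun ω ↦ ∫ s, Z s ω ∂ν) 2 P := by
  have hm := hZ.aestronglyMeasurable.integral_prod_right'
  refine (memLp_two_iff_integrable_sq hm).2 ?_
  refine ((hZ.integrable_sq.integral_prod_left).mul_const (ν.real Set.univ)).mono' (hm.pow 2) ?_
  filter_upwards [hZ.integrable_sq.prod_right_ae, hZ.aestronglyMeasurable.prodMk_left]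
    with ω h1 h2
  have h3 : MemLp (fun s ↦ Z s ω) 2 ν := (memLp_two_iff_integrable_sq h2).2 h1
  have := sq_integral_mul_le h3 (memLp_const (1 : ℝ))
  simpa using this

theorem integral_mul_integral (hZ : MemLp (fun z : Ω × ℝ ↦ Z z.2 z.1) 2 (P.prod ν))
    {Y : Ω → ℝ} (hY : MemLp Y 2 P) :
    ∫ ω, (∫ s, Z s ω ∂ν) * Y ω ∂P = ∫ s, ∫ ω, Z s ω * Y ω ∂P ∂ν := by
  have hY' : MemLp (fun z : Ω × ℝ ↦ Y z.1) 2 (P.prod ν) := hY.comp_fst ν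
  rw [← integral_integral_swap (f := fun ω s ↦ Z s ω * Y ω) (hZ.integrable_mul hY')]
  simp_rw [integral_mul_const]

end Fubini

/-! ### Second moments of Wiener integrals in pathwise form. -/

namespace IsWienerProcess

variable {Ω : Type*} [MeasurableSpace Ω] {N : ℕ} {P : Measure Ω}
  {W : ℝ≥0 → Ω → Fin N → ℝ}

theorem memLp_two (hW : IsWienerProcess P W) (t : ℝ≥0) (l : Fin N) :
    MemLp (fun ω ↦ W t ω l) 2 P :=
  ((hW.brownian l).hasLaw_eval t).hasGaussianLaw.memLp_two

theorem ae_continuous (hW : IsWienerProcess P W) : ∀ᵐ ω ∂P, Continuous fun t ↦ W t ω := by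
  filter_upwards [ae_all_iff.2 fun l ↦ (hW.brownian l).cont] with ω h
  exact continuous_pi h

theorem memLp_two_dotProduct (hW : IsWienerProcess P W) (t : ℝ≥0) (x : Fin N → ℝ) :
    MemLp (fun ω ↦ x ⬝ᵥ W t ω) 2 P :=
  memLp_finsetSum _ fun l _ ↦ (hW.memLp_two t l).const_mul (x l)

variable [IsProbabilityMeasure P]

theorem integral_mul (hW : IsWienerProcess P W) (s r : ℝ≥0) (l m : Fin N) :
    ∫ ω, W s ω l * W r ω m ∂P = if l = m then (min s r : ℝ) else 0 := by
  split_ifs with h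
  · subst h
    have h1 := (hW.brownian l).covariance_fun_eval s r
    rw [covariance_eq_sub (hW.memLp_two s l) (hW.memLp_two r l),
      (hW.brownian l).integral_eval s] at h1
    simpa using h1
  · have h1 : IndepFun (fun ω ↦ W s ω l) (fun ω ↦ W r ω m) P :=
      (hW.indep.indepFun h).comp (measurable_pi_apply s) (measurable_pi_apply r)
    rw [h1.integral_fun_mul_eq_mul_integral (hW.memLp_two s l).aestronglyMeasurable
      (hW.memLp_two r m).aestronglyMeasurable, (hW.brownian l).integral_eval s, zero_mul]

theorem integral_dotProduct_mul (hW : IsWienerProcess P W) (s r : ℝ≥0) (x y : Fin N → ℝ) :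
    ∫ ω, (x ⬝ᵥ W s ω) * (y ⬝ᵥ W r ω) ∂P = (x ⬝ᵥ y) * (min s r : ℝ) := by
  have hint (l m : Fin N) :
      Integrable (fun ω ↦ x l * W s ω l * (y m * W r ω m)) P :=
    ((hW.memLp_two s l).const_mul (x l)).integrable_mul ((hW.memLp_two r m).const_mul (y m))
  simp_rw [dotProduct, Finset.sum_mul_sum]
  rw [integral_finsetSum _ fun l _ ↦ integrable_finsetSum _ fun m _ ↦ hint l m, Finset.sum_mul]
  refine Finset.sum_congr rfl fun l _ ↦ ?_
  rw [integral_finsetSum _ fun m _ ↦ hint l m]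
  have e (m : Fin N) : ∫ ω, x l * W s ω l * (y m * W r ω m) ∂P
      = x l * y m * if l = m then (min s r : ℝ) else 0 := by
    rw [← hW.integral_mul, ← integral_const_mul]
    exact integral_congr_ae (.of_forall fun ω ↦ by ring)
  simp [e]

/-- Paths of a one-dimensional projection weighted by `f` are square integrable on `Ω × (0, t]`. -/
theorem memLp_two_weighted (hW : IsWienerProcess P W) (x : Fin N → ℝ) {f : ℝ → ℝ}
    (hf : Continuous f) (t : ℝ) :
    MemLp (fun z : Ω × ℝ ↦ f z.2 * (x ⬝ᵥ W z.2.toNNReal z.1)) 2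
      (P.prod (volume.restrict (Set.Ioc 0 t))) := by
  obtain ⟨M, hM⟩ := (isCompact_Icc (a := (0 : ℝ)) (b := t)).exists_bound_of_continuousOn
    (f := fun s ↦ f s ^ 2 * ((x ⬝ᵥ x) * s)) (by fun_prop)
  refine memLp_two_prod (Z := fun s ω ↦ f s * (x ⬝ᵥ W s.toNNReal ω)) (C := M) ?_ ?_ ?_
  · refine AEStronglyMeasurable.mul ?_ ?_
    · exact (hf.measurable.comp measurable_snd).aestronglyMeasurable
    · refine aestronglyMeasurable_prod_of_continuous (B := fun t ω ↦ x ⬝ᵥ W t ω)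
        (fun t ↦ (hW.memLp_two_dotProduct t x).aemeasurable) ?_ _
      filter_upwards [hW.ae_continuous] with ω h
      simp only [dotProduct]
      fun_prop
  · exact .of_forall fun s ↦ (hW.memLp_two_dotProduct _ x).const_mul (f s)
  · filter_upwards [ae_restrict_mem measurableSet_Ioc] with s hs
    have := hW.integral_dotProduct_mul s.toNNReal s.toNNReal x x
    simp_rw [mul_pow, integral_const_mul, pow_two (x ⬝ᵥ _), this]
    rw [min_self, Real.coe_toNNReal s hs.1.le]
    exact (le_abs_self _).trans (hM s ⟨hs.1.le, hs.2⟩)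

theorem memLp_two_integral (hW : IsWienerProcess P W) (x : Fin N → ℝ) {f : ℝ → ℝ}
    (hf : Continuous f) {t : ℝ} (ht : 0 ≤ t) :
    MemLp (fun ω ↦ ∫ s in (0 : ℝ)..t, f s * (x ⬝ᵥ W s.toNNReal ω)) 2 P := by
  simp_rw [intervalIntegral.integral_of_le ht]
  exact _root_.memLp_two_integral (Z := fun s ω ↦ f s * (x ⬝ᵥ W s.toNNReal ω))
    (hW.memLp_two_weighted x hf t)

/-- Two applications of Fubini bring the expectation inside both time integrals, onto the covariance
`(x ⬝ᵥ y) * min s r`. For orthogonal `x`, `y` the integrals are thus uncorrelated. -/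
theorem integral_integral_mul_integral (hW : IsWienerProcess P W) (x y : Fin N → ℝ)
    {f g : ℝ → ℝ} (hf : Continuous f) (hg : Continuous g) {t : ℝ} (ht : 0 ≤ t) :
    ∫ ω, (∫ s in (0 : ℝ)..t, f s * (x ⬝ᵥ W s.toNNReal ω))
        * (∫ s in (0 : ℝ)..t, g s * (y ⬝ᵥ W s.toNNReal ω)) ∂P
      = (x ⬝ᵥ y) * ∫ s in (0 : ℝ)..t, ∫ r in (0 : ℝ)..t, f s * (g r * min s r) := by
  have hL := hW.memLp_two_integral y hg ht
  simp_rw [intervalIntegral.integral_of_le ht] at hL ⊢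
  rw [_root_.integral_mul_integral (Z := fun s ω ↦ f s * (x ⬝ᵥ W s.toNNReal ω))
    (hW.memLp_two_weighted x hf t) hL, ← integral_const_mul]
  refine setIntegral_congr_fun measurableSet_Ioc fun s hs ↦ ?_
  have e1 : ∫ ω, f s * (x ⬝ᵥ W s.toNNReal ω)
        * (∫ r in Set.Ioc 0 t, g r * (y ⬝ᵥ W r.toNNReal ω)) ∂P
      = f s * ∫ ω, (∫ r in Set.Ioc 0 t, g r * (y ⬝ᵥ W r.toNNReal ω))
        * (x ⬝ᵥ W s.toNNReal ω) ∂P := by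
    rw [← integral_const_mul]
    exact integral_congr_ae (.of_forall fun ω ↦ by ring)
  simp only [e1]
  rw [_root_.integral_mul_integral (Z := fun s ω ↦ g s * (y ⬝ᵥ W s.toNNReal ω))
    (hW.memLp_two_weighted y hg t) (hW.memLp_two_dotProduct _ x), integral_const_mul,
    mul_left_comm, ← integral_const_mul (x ⬝ᵥ y)]
  congr 1
  refine setIntegral_congr_fun measurableSet_Ioc fun r hr ↦ ?_
  have e2 : ∫ ω, g r * (y ⬝ᵥ W r.toNNReal ω) * (x ⬝ᵥ W s.toNNReal ω) ∂P
      = g r * ∫ ω, (x ⬝ᵥ W s.toNNReal ω) * (y ⬝ᵥ W r.toNNReal ω) ∂P := by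
    rw [← integral_const_mul]
    exact integral_congr_ae (.of_forall fun ω ↦ by ring)
  simp only [e2]
  rw [hW.integral_dotProduct_mul, Real.coe_toNNReal s hs.1.le, Real.coe_toNNReal r hr.1.le]
  ring

end IsWienerProcess

/-! ### Limits of second moments of sums. -/

section SecondMoment

variable {Ω T : Type*} [MeasurableSpace Ω] {P : Measure Ω} {l : Filter T}

/-- Cauchy–Schwarz makes the cross term negligible, so the initial state and the noise may be
correlated. -/
theorem tendsto_integral_add_sq {Q R : T → Ω → ℝ} {v : ℝ} (hQ : ∀ t, MemLp (Q t) 2 P)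
    (hR : ∀ t, MemLp (R t) 2 P) (hQ0 : Tendsto (fun t ↦ ∫ ω, Q t ω ^ 2 ∂P) l (𝓝 0))
    (hRv : Tendsto (fun t ↦ ∫ ω, R t ω ^ 2 ∂P) l (𝓝 v)) :
    Tendsto (fun t ↦ ∫ ω, (Q t ω + R t ω) ^ 2 ∂P) l (𝓝 v) := by
  have hcross : Tendsto (fun t ↦ ∫ ω, Q t ω * R t ω ∂P) l (𝓝 0) := by
    refine tendsto_zero_of_sq (squeeze_zero (fun t ↦ sq_nonneg _)
      (fun t ↦ sq_integral_mul_le (hQ t) (hR t)) ?_)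
    simpa using hQ0.mul hRv
  have e (t : T) : ∫ ω, (Q t ω + R t ω) ^ 2 ∂P
      = ∫ ω, Q t ω ^ 2 ∂P + 2 * ∫ ω, Q t ω * R t ω ∂P + ∫ ω, R t ω ^ 2 ∂P := by
    have hQR : Integrable (fun ω ↦ Q t ω * R t ω) P := (hQ t).integrable_mul (hR t)
    have h12 : Integrable (fun ω ↦ Q t ω ^ 2 + 2 * (Q t ω * R t ω)) P :=
      (hQ t).integrable_sq.add (hQR.const_mul _)
    rw [← integral_const_mul, ← integral_add (hQ t).integrable_sq (hQR.const_mul _),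
      ← integral_add h12 (hR t).integrable_sq]
    exact integral_congr_ae (.of_forall fun ω ↦ by ring)
  simp_rw [e]
  simpa using (hQ0.add (hcross.const_mul 2)).add hRv

theorem tendsto_integral_sum_sq_zero {ι : Type*} (S : Finset ι) {Q : ι → T → Ω → ℝ}
    (hQ : ∀ i ∈ S, ∀ t, MemLp (Q i t) 2 P)
    (hQ0 : ∀ i ∈ S, Tendsto (fun t ↦ ∫ ω, Q i t ω ^ 2 ∂P) l (𝓝 0)) :
    Tendsto (fun t ↦ ∫ ω, (∑ i ∈ S, Q i t ω) ^ 2 ∂P) l (𝓝 0) := by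
  classical
  induction S using Finset.induction_on with
  | empty => simpa using tendsto_const_nhds
  | insert i S hi ih =>
    simp_rw [Finset.sum_insert hi]
    rw [Finset.forall_mem_insert] at hQ hQ0
    exact tendsto_integral_add_sq hQ.1 (fun t ↦ memLp_finsetSum S fun m hm ↦ hQ.2 m hm t) hQ0.1
      (ih hQ.2 hQ0.2)

theorem tendsto_integral_smul_sq_zero {Z : Ω → ℝ} {q : T → ℝ}
    (hq : Tendsto q l (𝓝 0)) : Tendsto (fun t ↦ ∫ ω, (q t * Z ω) ^ 2 ∂P) l (𝓝 0) := by
  simp_rw [mul_pow, integral_const_mul]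
  simpa using (hq.pow 2).mul_const (∫ ω, Z ω ^ 2 ∂P)

end SecondMoment

/-! ### Spectral facts about the Laplacian. -/

section Spectral

variable {N : ℕ} {G : SimpleGraph (Fin N)} [DecidableRel G.Adj] {lam : Fin N → ℝ}
  {u : Fin N → Fin N → ℝ}

/-- Expansion in an orthonormal basis. -/
theorem sum_dotProduct_mul_of_orthonormal (h_orth : ∀ i m, u i ⬝ᵥ u m = if i = m then 1 else 0)
    (x : Fin N → ℝ) (j : Fin N) : ∑ i, (u i ⬝ᵥ x) * u i j = x j := by
  have h1 : Matrix.of u * (Matrix.of u)ᵀ = 1 := by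
    ext i m
    rw [Matrix.mul_apply', Matrix.one_apply]
    exact h_orth i m
  have h2 := congrFun (congrArg (· *ᵥ x) (mul_eq_one_comm.1 h1)) j
  simp only [← Matrix.mulVec_mulVec, Matrix.one_mulVec] at h2
  rw [← h2]
  simp [Matrix.mulVec, dotProduct, mul_comm]

theorem lapMatrix_eigenvalue_nonneg {x : Fin N → ℝ} {a : ℝ} (hx : G.lapMatrix ℝ *ᵥ x = a • x)
    (h1 : x ⬝ᵥ x = 1) : 0 ≤ a := by
  have := (G.posSemidef_lapMatrix ℝ).dotProduct_mulVec_nonneg x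
  simpa [hx, h1] using this

theorem lapMatrix_dotProduct_comm (x y : Fin N → ℝ) :
    x ⬝ᵥ (G.lapMatrix ℝ *ᵥ y) = (G.lapMatrix ℝ *ᵥ x) ⬝ᵥ y := by
  rw [Matrix.dotProduct_mulVec, ← Matrix.mulVec_transpose, (G.isSymm_lapMatrix (R := ℝ)).eq]

/-- The constant vector lies in the kernel of the symmetric Laplacian, so it is orthogonal to every
eigenvector of nonzero eigenvalue. If no eigenvalue vanished, its expansion would be zero. -/
theorem exists_lapMatrix_eigenvalue_eq_zero [Nonempty (Fin N)]
    (h_eig : ∀ i, G.lapMatrix ℝ *ᵥ u i = lam i • u i)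
    (h_orth : ∀ i m, u i ⬝ᵥ u m = if i = m then 1 else 0) : ∃ i, lam i = 0 := by
  by_contra! h
  have h0 (i : Fin N) : u i ⬝ᵥ (fun _ ↦ 1) = 0 := by
    have := lapMatrix_dotProduct_comm (G := G) (u i) (fun _ ↦ 1)
    rw [G.lapMatrix_mulVec_const_eq_zero, h_eig, dotProduct_zero, smul_dotProduct, smul_eq_mul]
      at this
    exact (mul_eq_zero.1 this.symm).resolve_left (h i)
  have := sum_dotProduct_mul_of_orthonormal h_orth (fun _ ↦ 1) (Classical.arbitrary (Fin N))
  simp [h0] at this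

theorem apply_eq_apply_of_lapMatrix_mulVec_eq_zero (hG : G.Connected) {x : Fin N → ℝ}
    (hx : G.lapMatrix ℝ *ᵥ x = 0) (j k : Fin N) : x j = x k :=
  (G.lapMatrix_mulVec_eq_zero_iff_forall_reachable).1 hx j k (hG.preconnected j k)

end Spectral

/-! ### Decoupling into modes. -/

namespace IsConsensusSolution

variable {Ω : Type*} [MeasurableSpace Ω] {N : ℕ} {G : SimpleGraph (Fin N)} [DecidableRel G.Adj]
  {P : Measure Ω} {W : ℝ≥0 → Ω → Fin N → ℝ} {X : ℝ≥0 → Ω → Fin N ⊕ Fin N → ℝ}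

/-- The projections of a solution on an eigenvector of the Laplacian. -/
theorem ae_mode_eq (hX : IsConsensusSolution G P W X)
    (hW : ∀ᵐ ω ∂P, Continuous fun t ↦ W t ω) {x : Fin N → ℝ} {a : ℝ}
    (hx : G.lapMatrix ℝ *ᵥ x = a • x) {p g : ℝ → ℝ} (hpg : IsImpulseKernel a p g) :
    ∀ᵐ ω ∂P, ∀ t : ℝ≥0, x ⬝ᵥ (X t ω ∘ Sum.inl)
      = p t * (x ⬝ᵥ (X 0 ω ∘ Sum.inl)) + g t * (x ⬝ᵥ (X 0 ω ∘ Sum.inr))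
        + ∫ s in (0 : ℝ)..t, (p (t - s) - a * g (t - s)) * (x ⬝ᵥ W s.toNNReal ω) := by
  filter_upwards [hX.cont, hX.eqn, hW] with ω hc he hWc t
  let φ (ι : Fin N → Fin N ⊕ Fin N) : (Fin N ⊕ Fin N → ℝ) →L[ℝ] ℝ :=
    ∑ j, x j • ContinuousLinearMap.proj (ι j)
  have hφ (ι : Fin N → Fin N ⊕ Fin N) (y) : φ ι y = x ⬝ᵥ (y ∘ ι) := by
    simp [φ, dotProduct]
  have hXc : Continuous fun s : ℝ ↦ X s.toNNReal ω := hc.comp continuous_real_toNNReal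
  have hMc : Continuous fun s : ℝ ↦ consensusMatrix G *ᵥ X s.toNNReal ω :=
    continuous_const.matrix_mulVec hXc
  have hint (ι : Fin N → Fin N ⊕ Fin N) (s : ℝ) (hs : 0 ≤ s) :
      x ⬝ᵥ (X s.toNNReal ω ∘ ι) = x ⬝ᵥ (X 0 ω ∘ ι)
        + (∫ r in (0 : ℝ)..s, x ⬝ᵥ ((consensusMatrix G *ᵥ X r.toNNReal ω) ∘ ι))
        + x ⬝ᵥ ((noiseMatrix N *ᵥ W s.toNNReal ω) ∘ ι) := by
    have := congrArg (φ ι) (he s.toNNReal)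
    rw [map_add, map_add, ← ContinuousLinearMap.intervalIntegral_comp_comm _
      (hMc.intervalIntegrable _ _), Real.coe_toNNReal s hs] at this
    simpa only [hφ] using this
  have hinl (y : Fin N ⊕ Fin N → ℝ) :
      x ⬝ᵥ ((consensusMatrix G *ᵥ y) ∘ Sum.inl) = x ⬝ᵥ (y ∘ Sum.inr) := by
    simp [consensusMatrix, Matrix.fromBlocks_mulVec]
  have hinr (y : Fin N ⊕ Fin N → ℝ) :
      x ⬝ᵥ ((consensusMatrix G *ᵥ y) ∘ Sum.inr)
        = -a * (x ⬝ᵥ (y ∘ Sum.inl)) - a * (x ⬝ᵥ (y ∘ Sum.inr)) := by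
    simp [consensusMatrix, Matrix.fromBlocks_mulVec, Matrix.neg_mulVec, lapMatrix_dotProduct_comm,
      hx, sub_eq_add_neg]
  have hnl (y : Fin N → ℝ) : x ⬝ᵥ ((noiseMatrix N *ᵥ y) ∘ Sum.inl) = 0 := by
    simp [noiseMatrix, Matrix.fromRows_mulVec]
  have hnr (y : Fin N → ℝ) : x ⬝ᵥ ((noiseMatrix N *ᵥ y) ∘ Sum.inr) = x ⬝ᵥ y := by
    simp [noiseMatrix, Matrix.fromRows_mulVec]
  have hproj (ι : Fin N → Fin N ⊕ Fin N) : Continuous fun s : ℝ ↦ x ⬝ᵥ (X s.toNNReal ω ∘ ι) := by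
    simp_rw [← hφ]
    exact (φ ι).continuous.comp hXc
  have hWx : Continuous fun s : ℝ ↦ x ⬝ᵥ W s.toNNReal ω := by
    have := hWc.comp continuous_real_toNNReal
    exact continuous_const.dotProduct this
  have := hpg.variation_of_constants (hproj Sum.inl) (hproj Sum.inr) hWx
    (fun s hs ↦ by simpa [hinl, hnl] using hint Sum.inl s hs)
    (fun s hs ↦ by simpa [hinr, hnr] using hint Sum.inr s hs) t.coe_nonneg
  simpa using this

end IsConsensusSolution

/-! ### Assembly of the modes. -/

theorem mainTheorem4 {N : ℕ} (G : SimpleGraph (Fin N)) [DecidableRel G.Adj]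
    (hG : G.Connected)
    (lam : Fin N → ℝ) (u : Fin N → Fin N → ℝ)
    (h_mono : Monotone lam)
    (h_eig : ∀ i, G.lapMatrix ℝ *ᵥ u i = lam i • u i)
    (h_orth : ∀ i m, u i ⬝ᵥ u m = if i = m then 1 else 0)
    {Ω : Type*} [MeasurableSpace Ω] (P : Measure Ω) [IsProbabilityMeasure P]
    (W : ℝ≥0 → Ω → Fin N → ℝ) (hW : IsWienerProcess P W)
    (X : ℝ≥0 → Ω → Fin N ⊕ Fin N → ℝ) (hX : IsConsensusSolution G P W X)
    (hX0 : ∀ a, MemLp (fun ω ↦ X 0 ω a) 2 P)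
    (j k : Fin N) :
    HasPairwiseVariance P X j k
      (∑ i ∈ Finset.univ.filter (fun i : Fin N ↦ 1 ≤ i.val), (u i j - u i k) ^ 2 / (2 * lam i ^ 2)) := by
  have := hG.nonempty
  have hnonneg (i : Fin N) : 0 ≤ lam i :=
    lapMatrix_eigenvalue_nonneg (h_eig i) (by simp [h_orth])
  have hconst (i : Fin N) (hi : lam i = 0) : u i j - u i k = 0 :=
    sub_eq_zero.2 (apply_eq_apply_of_lapMatrix_mulVec_eq_zero hG (by rw [h_eig, hi, zero_smul]) j k)
  obtain ⟨i₀, hi₀⟩ := exists_lapMatrix_eigenvalue_eq_zero h_eig h_orth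
  -- Summing over positive eigenvalues avoids proving that 0 is a simple eigenvalue: every term with
  -- `lam i = 0` carries the factor `u i j - u i k = 0`. Index 0 is such a term because `lam` is
  -- monotone and nonnegative and vanishes at `i₀`.
  set S : Finset (Fin N) := Finset.univ.filter fun i ↦ 0 < lam i
  have hS {f : Fin N → ℝ} (hf : ∀ i, lam i = 0 → f i = 0) : ∑ i ∈ S, f i = ∑ i, f i :=
    Finset.sum_subset (Finset.subset_univ _) fun i _ hi ↦
      hf i (le_antisymm (by simpa [S] using hi) (hnonneg i))
  have hv : ∑ i ∈ Finset.univ.filter (fun i : Fin N ↦ 1 ≤ i.val),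
      (u i j - u i k) ^ 2 / (2 * lam i ^ 2)
      = ∑ i ∈ S, (u i j - u i k) ^ 2 * (1 / (2 * lam i ^ 2)) := by
    simp_rw [mul_one_div]
    rw [hS fun i hi ↦ by simp [hconst i hi]]
    refine Finset.sum_subset (Finset.subset_univ _) fun i _ hi ↦ ?_
    have hi0 : i.val = 0 := by simpa using hi
    have : lam i = 0 := le_antisymm
      (hi₀ ▸ h_mono (Fin.le_def.2 (hi0.symm ▸ Nat.zero_le _))) (hnonneg i)
    simp [hconst i this]
  rw [hv]
  choose p g hpg using fun i ↦ exists_isImpulseKernel (lam i)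
  let f (i : Fin N) (t s : ℝ) : ℝ := p i (t - s) - lam i * g i (t - s)
  have hf (i : Fin N) (t : ℝ) : Continuous (f i t) := by
    have := (hpg i).continuous_left
    have := (hpg i).continuous_right
    fun_prop
  let I (i : Fin N) (t : ℝ≥0) (ω : Ω) : ℝ :=
    ∫ s in (0 : ℝ)..t, f i t s * (u i ⬝ᵥ W s.toNNReal ω)
  have hI (i : Fin N) (t : ℝ≥0) : MemLp (I i t) 2 P :=
    hW.memLp_two_integral (u i) (hf i t) t.coe_nonneg
  -- `Q` is the contribution of the initial state, which dies out; `R` is that of the noise, which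
  -- carries the limit.
  let Q (i : Fin N) (t : ℝ≥0) (ω : Ω) : ℝ :=
    (u i j - u i k) * p i t * (u i ⬝ᵥ (X 0 ω ∘ Sum.inl))
      + (u i j - u i k) * g i t * (u i ⬝ᵥ (X 0 ω ∘ Sum.inr))
  let R (t : ℝ≥0) (ω : Ω) : ℝ := ∑ i ∈ S, (u i j - u i k) * I i t ω
  have hZ (i : Fin N) (ι : Fin N → Fin N ⊕ Fin N) :
      MemLp (fun ω ↦ u i ⬝ᵥ (X 0 ω ∘ ι)) 2 P :=
    memLp_finsetSum _ fun m _ ↦ (hX0 (ι m)).const_mul (u i m)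
  have hQ (i : Fin N) (t : ℝ≥0) : MemLp (Q i t) 2 P :=
    ((hZ i Sum.inl).const_mul _).add ((hZ i Sum.inr).const_mul _)
  have hQS (t : ℝ≥0) : MemLp (fun ω ↦ ∑ i ∈ S, Q i t ω) 2 P :=
    memLp_finsetSum _ fun i _ ↦ hQ i t
  have hR (t : ℝ≥0) : MemLp (R t) 2 P :=
    memLp_finsetSum _ fun i _ ↦ (hI i t).const_mul _
  have hdecomp (t : ℝ≥0) :
      (fun ω ↦ X t ω (Sum.inl j) - X t ω (Sum.inl k)) =ᵐ[P] fun ω ↦ ∑ i ∈ S, Q i t ω + R t ω := by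
    filter_upwards [ae_all_iff.2 fun i ↦ hX.ae_mode_eq hW.ae_continuous (h_eig i) (hpg i)]
      with ω h
    have e := sum_dotProduct_mul_of_orthonormal h_orth (X t ω ∘ Sum.inl)
    have hj := e j
    have hk := e k
    simp only [Function.comp_apply] at hj hk
    rw [← hj, ← hk, ← Finset.sum_sub_distrib, ← hS fun i hi ↦ by
      rw [← mul_sub, hconst i hi, mul_zero], ← Finset.sum_add_distrib]
    refine Finset.sum_congr rfl fun i _ ↦ ?_
    rw [h i t]
    simp only [Q, I, f]
    ring
  have htop : Tendsto (fun t : ℝ≥0 ↦ (t : ℝ)) atTop atTop := NNReal.tendsto_coe_atTop.2 tendsto_id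
  have hQlim : Tendsto (fun t ↦ ∫ ω, (∑ i ∈ S, Q i t ω) ^ 2 ∂P) atTop (𝓝 0) := by
    refine tendsto_integral_sum_sq_zero S (fun i _ t ↦ hQ i t) fun i hi ↦ ?_
    have hi : 0 < lam i := by simpa [S] using hi
    refine tendsto_integral_add_sq (fun t ↦ (hZ i Sum.inl).const_mul _)
      (fun t ↦ (hZ i Sum.inr).const_mul _)
      (tendsto_integral_smul_sq_zero ?_) (tendsto_integral_smul_sq_zero ?_)
    · simpa using (((hpg i).tendsto_left hi).comp htop).const_mul (u i j - u i k)
    · simpa using (((hpg i).tendsto_right hi).comp htop).const_mul (u i j - u i k)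
  have hRsq (t : ℝ≥0) : ∫ ω, R t ω ^ 2 ∂P
      = ∑ i ∈ S, (u i j - u i k) ^ 2 * ∫ s in (0 : ℝ)..t, g i s ^ 2 := by
    have hint (i m : Fin N) :
        Integrable (fun ω ↦ (u i j - u i k) * I i t ω * ((u m j - u m k) * I m t ω)) P :=
      ((hI i t).const_mul _).integrable_mul ((hI m t).const_mul _)
    have hmul (i m : Fin N) :
        ∫ ω, (u i j - u i k) * I i t ω * ((u m j - u m k) * I m t ω) ∂P
          = (u i j - u i k) * (u m j - u m k) * ((u i ⬝ᵥ u m) *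
            ∫ s in (0 : ℝ)..t, ∫ r in (0 : ℝ)..t, f i t s * (f m t r * min s r)) := by
      rw [← hW.integral_integral_mul_integral (u i) (u m) (hf i t) (hf m t) t.coe_nonneg,
        ← integral_const_mul]
      exact integral_congr_ae (.of_forall fun ω ↦ mul_mul_mul_comm _ _ _ _)
    simp only [R, pow_two (∑ i ∈ S, _), Finset.sum_mul_sum]
    rw [integral_finsetSum _ fun i _ ↦ integrable_finsetSum _ fun m _ ↦ hint i m]
    refine Finset.sum_congr rfl fun i hi ↦ ?_
    -- Only the diagonal `m = i` survives, by orthonormality of the eigenvectors.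
    rw [integral_finsetSum _ fun m _ ↦ hint i m, Finset.sum_eq_single_of_mem i hi fun m _ hm ↦ ?_]
    · rw [hmul, h_orth, if_pos rfl, one_mul, ← pow_two]
      exact congrArg _ ((hpg i).integral_integral_min t.coe_nonneg)
    · rw [hmul, h_orth, if_neg hm.symm, zero_mul, mul_zero]
  have hRlim : Tendsto (fun t ↦ ∫ ω, R t ω ^ 2 ∂P) atTop
      (𝓝 (∑ i ∈ S, (u i j - u i k) ^ 2 * (1 / (2 * lam i ^ 2)))) := by
    simp_rw [hRsq]
    refine tendsto_finsetSum _ fun i hi ↦ ?_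
    have hi : 0 < lam i := by simpa [S] using hi
    exact (((hpg i).tendsto_integral_sq hi).comp htop).const_mul _
  refine ⟨fun t ↦ ((hQS t).add (hR t)).integrable_sq.congr ?_, ?_⟩
  · filter_upwards [hdecomp t] with ω h
    simp [h]
  · refine (tendsto_integral_add_sq hQS hR hQlim hRlim).congr fun t ↦ integral_congr_ae ?_
    filter_upwards [hdecomp t] with ω h
    rw [h]
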